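/- A normally regular digraph $\mathrm{NRD}(v,k,\lambda,\mu)$ is a loopless directed graph on $v$ vertices in which every vertex has out-degree $k$, and in which any two distinct vertices $x,y$ have exactly $\mu$ common out-neighbours if neither of the edges $x\to y$, $y\to x$ is present, exactly $\lambda$ if exactly one of them is present, and exactly $2\lambda-\mu$ if both are present. For an abelian group $A$ and $S\subset A\setminus\{0\}$, $\mathrm{Cay}(A,S)$ is the digraph with vertex set $A$ and edges $x\to y$ for $y-x\in S$. **Theorem.** Let $q$ be a prime power, let $r\ge 2$ be an integer not divisible by $3$, and put $u=q^{2r}+q^r+1$. Then $q^2+q+1$ divides $u$; let $v=\frac{q^{2r}+q^r+1}{q^2+q+1}$. There is a set $S\subset\mathbb Z_v\setminus\{0\}$ such that $\mathrm{Cay}(\mathbb Z_v,S)$ is an $\mathrm{NRD}(v,\;q^r-q,\;q^2,\;q^2+q+1)$. Moreover, such an $S$ is obtained as follows. Let $\alpha$ be any primitive element of $\mathrm{GF}(q^{3r})$ and let $\beta=\alpha^{(q^{3r}-1)/(q^3-1)}$, a primitive element of $\mathrm{GF}(q^3)$. Let $D\subset\mathbb Z_u$ be the set of residues modulo $u$ of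 those integers $n\ge 0$ for which $\alpha^n$ lies in the $\mathrm{GF}(q^r)$-span of $1,\beta$, and let $T\subset\mathbb Z_u$ be the set of residues modulo $u$ of those $n\ge 0$ for which $\alpha^n$ lies in the $\mathrm{GF}(q)$-span of $1,\beta$. Then $D$ is a (Singer) planar difference set in $\mathbb Z_u$, i.e. every nonzero element of $\mathbb Z_u$ is the difference of exactly one ordered pair of elements of $D$; $T\subset D$, and $T$ is a planar difference set in the subgroup $\langle v\rangle$ of $\mathbb Z_u$; and the image $S$ of $D\setminus T$ under reduction $\mathbb Z_u\to\mathbb Z_v$ does not contain $0$ and makes $\mathrm{Cay}(\mathbb Z_v,S)$ an $\mathrm{NRD}(v,q^r-q,q^2,q^2+q+1)$. -/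

import Mathlib

/-- `G` is a normally regular digraph with parameters `(v, k, l, m)` (the last two are usually
written `λ`, `μ`): a loopless directed graph on `v` vertices in which every vertex has out-degree
`k`, and in which the number of common out-neighbours of two distinct vertices is `m`, `l` or
`2 l - m` according to whether none, exactly one or both of the two possible edges between them
are present. The last number is an integer that may be negative (then the third case cannot
occur). -/
structure IsNRD {V : Type*} (G : Digraph V) (v k l m : ℕ) : Prop where
  finite : Finite V
  card_vertices : Nat.card V = v
  loopless : ∀ x, ¬ G.Adj x x
  outdegree : ∀ x, {z | G.Adj x z}.ncard = k
  common_of_none : ∀ x y, x ≠ y → ¬ G.Adj x y → ¬ G.Adj y x →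
    {z | G.Adj x z ∧ G.Adj y z}.ncard = m
  common_of_one : ∀ x y, x ≠ y → Xor (G.Adj x y) (G.Adj y x) →
    {z | G.Adj x z ∧ G.Adj y z}.ncard = l
  common_of_both : ∀ x y, x ≠ y → G.Adj x y → G.Adj y x →
    ({z | G.Adj x z ∧ G.Adj y z}.ncard : ℤ) = 2 * (l : ℤ) - (m : ℤ)

/-- The Cayley digraph `Cay(A, S)` of an additive group: `x → y` if and only if `-x + y ∈ S`. -/
def addCayleyDigraph {A : Type*} [AddGroup A] (S : Set A) : Digraph A where
  Adj x y := -x + y ∈ S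

/-- `D` is a planar difference set in the subgroup `H` of `A`: a subset of `H` such that every
nonzero element of `H` is the difference of exactly one ordered pair of elements of `D`. -/
def IsPlanarDifferenceSetIn {A : Type*} [AddGroup A] (H : AddSubgroup A) (D : Set A) : Prop :=
  D ⊆ (H : Set A) ∧ ∀ g ∈ H, g ≠ 0 → ∃! p : A × A, p.1 ∈ D ∧ p.2 ∈ D ∧ p.1 - p.2 = g

/-- The residues modulo `u` of the exponents `n` for which `α ^ n` lies in the `F`-subspace of `K`
spanned by `1` and `β`. -/
def logSet {K : Type*} [Field K] (F : Subfield K) (α β : K) (u : ℕ) : Set (ZMod u) :=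
  {i | ∃ n : ℕ, (n : ZMod u) = i ∧ α ^ n ∈ Submodule.span F ({1, β} : Set K)}

/-! Write φ for reduction `ZMod u → ZMod v`; its kernel ⟨v⟩ has order q²+q+1. A nonzero g in `ZMod
v` has q²+q+1 lifts, each a difference of D in exactly one way, so exactly q²+q+1 pairs of D have
φ-difference g. Sort them by membership in T, on which φ vanishes. No pair lies in T × T; pairs in
(D \ T)² are the common out-neighbours of x and y, where g = y - x; mixed pairs number |T| = q+1 for
each edge between x and y. Hence the counts μ = q²+q+1, λ = q² and 2λ - μ
(`IsPlanarDifferenceSetIn.ncard_common`). Uniqueness of differences also makes φ injective and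
nonzero on D \ T.

Differences exist because a plane in a 3-space over F or E meets each of its nonzero multiples
(`Subfield.exists_mem_span_eq_mul`). For D, the bound |D| ≤ q^r+1 then forces uniqueness; T inherits
uniqueness from D. That T realises all of ⟨v⟩ uses 3 ∤ r, through `coprime_div_sub_one`. -/

/-! ### Counting in planar difference sets. -/

theorem IsPlanarDifferenceSetIn.ncard_mul_pred {A : Type*} [AddGroup A] [Finite A]
    {H : AddSubgroup A} {D : Set A} (h : IsPlanarDifferenceSetIn H D) :
    D.ncard * (D.ncard - 1) = Nat.card H - 1 := by
  classical
  have := Fintype.ofFinite A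
  have hb : (D.toFinset.offDiag).card = ((H : Set A).toFinset.erase 0).card := by
    apply Finset.card_bij (fun p _ => p.1 - p.2)
    · simp only [Finset.mem_offDiag, Set.mem_toFinset, Finset.mem_erase, SetLike.mem_coe]
      rintro ⟨a, b⟩ ⟨ha, hb, hab⟩
      exact ⟨sub_ne_zero.2 hab, H.sub_mem (h.1 ha) (h.1 hb)⟩
    · simp only [Finset.mem_offDiag, Set.mem_toFinset]
      rintro ⟨a, b⟩ ⟨ha, hb, hab⟩ ⟨a', b'⟩ ⟨ha', hb', _⟩ heq
      exact (h.2 (a - b) (H.sub_mem (h.1 ha) (h.1 hb)) (sub_ne_zero.2 hab)).unique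
        ⟨ha, hb, rfl⟩ ⟨ha', hb', heq.symm⟩
    · simp only [Finset.mem_offDiag, Set.mem_toFinset, Finset.mem_erase, SetLike.mem_coe]
      rintro g ⟨g0, hg⟩
      obtain ⟨p, ⟨h1, h2, h3⟩, -⟩ := h.2 g hg g0
      refine ⟨p, ⟨h1, h2, fun e => g0 ?_⟩, h3⟩
      rw [← h3, e, sub_self]
  rw [Finset.offDiag_card, Finset.card_erase_of_mem (by simp [H.zero_mem]),
    ← Set.ncard_eq_toFinset_card', ← Set.ncard_eq_toFinset_card'] at hb
  rw [Nat.mul_sub_one, hb]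
  rfl

/-- Subtraction maps at most n(n-1) off-diagonal pairs onto n(n-1) nonzero elements, hence is
injective. -/
theorem isPlanarDifferenceSetIn_top_of_ncard_le {A : Type*} [AddGroup A] [Finite A]
    {D : Set A} {n : ℕ} (hA : Nat.card A = n * (n - 1) + 1) (hn : D.ncard ≤ n)
    (h : ∀ g : A, g ≠ 0 → ∃ p : A × A, p.1 ∈ D ∧ p.2 ∈ D ∧ p.1 - p.2 = g) :
    IsPlanarDifferenceSetIn ⊤ D := by
  classical
  have := Fintype.ofFinite A
  refine ⟨fun _ _ => trivial, fun g _ hg => ?_⟩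
  have key := Finset.inj_on_of_surj_on_of_card_le (s := D.toFinset.offDiag)
    (t := Finset.univ.erase (0 : A)) (fun p _ => p.1 - p.2) (by
      simp only [Finset.mem_offDiag, Finset.mem_erase]
      rintro ⟨a, b⟩ ⟨ha, hb, hab⟩
      exact ⟨sub_ne_zero.2 hab, Finset.mem_univ _⟩) (by
      simp only [Finset.mem_offDiag, Set.mem_toFinset, Finset.mem_erase]
      rintro g ⟨g0, -⟩
      obtain ⟨p, h1, h2, h3⟩ := h g g0
      refine ⟨p, ⟨h1, h2, fun e => g0 ?_⟩, h3⟩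
      rw [← h3, e, sub_self]) (by
      rw [Finset.card_erase_of_mem (Finset.mem_univ _), Finset.card_univ,
        ← Nat.card_eq_fintype_card, hA, Finset.offDiag_card, ← Set.ncard_eq_toFinset_card',
        ← Nat.mul_sub_one, Nat.add_sub_cancel]
      gcongr)
  obtain ⟨p, h1, h2, h3⟩ := h g hg
  refine ⟨p, ⟨h1, h2, h3⟩, ?_⟩
  rintro p' ⟨h1', h2', h3'⟩
  apply key
  · simp only [Finset.mem_offDiag, Set.mem_toFinset]
    exact ⟨h1', h2', fun e => hg (by rw [← h3', e, sub_self])⟩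
  · simp only [Finset.mem_offDiag, Set.mem_toFinset]
    exact ⟨h1, h2, fun e => hg (by rw [← h3, e, sub_self])⟩
  · rw [h3, h3']

/-! ### Normally regular digraphs from a quotient of a planar difference set. -/

section Quotient

variable {A B : Type*} [AddCommGroup A] [AddCommGroup B] {φ : A →+ B} {D T : Set A}

/-- The difference d - d' lies in the kernel, so T already represents it, and D represents it only
once. -/
theorem IsPlanarDifferenceSetIn.mem_of_map_eq (hD : IsPlanarDifferenceSetIn ⊤ D)
    (hT : IsPlanarDifferenceSetIn φ.ker T) (hTD : T ⊆ D) {d d' : A} (hd : d ∈ D) (hd' : d' ∈ D)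
    (hne : d ≠ d') (hφ : φ d = φ d') : d ∈ T ∧ d' ∈ T := by
  have h0 : d - d' ≠ 0 := sub_ne_zero.2 hne
  obtain ⟨p, ⟨h1, h2, h3⟩, -⟩ := hT.2 (d - d') (by simp [AddMonoidHom.mem_ker, hφ]) h0
  have := (hD.2 (d - d') trivial h0).unique ⟨hTD h1, hTD h2, h3⟩
    (y₂ := (d, d')) ⟨hd, hd', rfl⟩
  subst this
  exact ⟨h1, h2⟩

theorem IsPlanarDifferenceSetIn.map_ne_zero (hD : IsPlanarDifferenceSetIn ⊤ D)
    (hT : IsPlanarDifferenceSetIn φ.ker T) (hTD : T ⊆ D) (hne : T.Nonempty) {d : A}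
    (hd : d ∈ D \ T) : φ d ≠ 0 := by
  intro h0
  obtain ⟨t, ht⟩ := hne
  have ht0 : φ t = 0 := hT.1 ht
  exact hd.2 (hD.mem_of_map_eq hT hTD hd.1 (hTD ht) (fun e => hd.2 (e ▸ ht))
    (h0.trans ht0.symm)).1

theorem IsPlanarDifferenceSetIn.map_injOn (hD : IsPlanarDifferenceSetIn ⊤ D)
    (hT : IsPlanarDifferenceSetIn φ.ker T) (hTD : T ⊆ D) : Set.InjOn φ (D \ T) := by
  intro d hd d' hd' h
  by_contra hne
  exact hd.2 (hD.mem_of_map_eq hT hTD hd.1 hd'.1 hne h).1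

theorem IsPlanarDifferenceSetIn.ncard_pairs [Finite A] (hD : IsPlanarDifferenceSetIn ⊤ D)
    (hφ : Function.Surjective φ) {g : B} (hg : g ≠ 0) :
    {p : A × A | p.1 ∈ D ∧ p.2 ∈ D ∧ φ p.1 - φ p.2 = g}.ncard = Nat.card φ.ker := by
  obtain ⟨a, rfl⟩ := hφ g
  have hne : ∀ k ∈ φ.ker, a + k ≠ 0 := fun k hk h => hg <| by
    have := congrArg φ h
    rwa [map_add, φ.mem_ker.1 hk, add_zero, map_zero] at this
  rw [← SetLike.coe_sort_coe, Nat.card_coe_set_eq]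
  apply Set.ncard_congr (fun p _ => p.1 - p.2 - a)
  · rintro ⟨x, y⟩ ⟨-, -, h⟩
    simp only [SetLike.mem_coe, AddMonoidHom.mem_ker, map_sub]
    rw [h, sub_self]
  · rintro p p' ⟨h1, h2, h3⟩ ⟨h1', h2', h3'⟩ h
    have h := sub_left_injective h
    have h0 : p.1 - p.2 ≠ 0 := fun e => hg (by rw [← h3, ← map_sub, e, map_zero])
    exact (hD.2 _ trivial h0).unique ⟨h1, h2, rfl⟩ ⟨h1', h2', h.symm⟩
  · intro k hk
    obtain ⟨p, ⟨h1, h2, h3⟩, -⟩ := hD.2 (a + k) trivial (hne k hk)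
    refine ⟨p, ⟨h1, h2, ?_⟩, by rw [h3]; abel⟩
    rw [← map_sub, h3, map_add, φ.mem_ker.1 hk, add_zero]

open Classical in
-- Both sides count the pairs of D with φ-difference y - x; the three summands are the parts outside
-- T × T, which contributes nothing.
theorem IsPlanarDifferenceSetIn.ncard_common [Finite A] [Finite B]
    (hD : IsPlanarDifferenceSetIn ⊤ D) (hT : IsPlanarDifferenceSetIn φ.ker T) (hTD : T ⊆ D)
    (hφ : Function.Surjective φ) {x y : B} (hxy : x ≠ y) :
    {z | (addCayleyDigraph (φ '' (D \ T))).Adj x z ∧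
      (addCayleyDigraph (φ '' (D \ T))).Adj y z}.ncard +
      (if (addCayleyDigraph (φ '' (D \ T))).Adj x y then T.ncard else 0) +
      (if (addCayleyDigraph (φ '' (D \ T))).Adj y x then T.ncard else 0) = Nat.card φ.ker := by
  have hT0 : ∀ t ∈ T, φ t = 0 := fun t ht => hT.1 ht
  have hinj := hD.map_injOn hT hTD
  have hg : -x + y ≠ 0 := fun h => hxy (neg_add_eq_zero.1 h)
  rw [← hD.ncard_pairs hφ hg]
  have h1 : {p : A × A | p.1 ∈ D \ T ∧ p.2 ∈ D \ T ∧ φ p.1 - φ p.2 = -x + y}.ncard =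
      {z | (addCayleyDigraph (φ '' (D \ T))).Adj x z ∧
        (addCayleyDigraph (φ '' (D \ T))).Adj y z}.ncard := by
    apply Set.ncard_congr (fun p _ => x + φ p.1)
    · rintro ⟨a, b⟩ ⟨ha, hb, h⟩
      refine ⟨⟨a, ha, by simp⟩, ⟨b, hb, ?_⟩⟩
      rw [sub_eq_iff_eq_add] at h
      simp only [h]
      abel
    · rintro ⟨a, b⟩ ⟨a', b'⟩ ⟨ha, hb, h⟩ ⟨ha', hb', h'⟩ e
      have e : φ a = φ a' := add_left_cancel e
      have e' : φ b = φ b' := by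
        have := h.trans h'.symm
        simp only [e] at this
        exact sub_right_injective this
      exact Prod.ext (hinj ha ha' e) (hinj hb hb' e')
    · rintro z ⟨⟨a, ha, h⟩, ⟨b, hb, h'⟩⟩
      refine ⟨(a, b), ⟨ha, hb, ?_⟩, ?_⟩
      · rw [h, h']; abel
      · rw [h]; abel
  have h2 : {p : A × A | p.1 ∈ D \ T ∧ p.2 ∈ T ∧ φ p.1 - φ p.2 = -x + y}.ncard =
      if (addCayleyDigraph (φ '' (D \ T))).Adj x y then T.ncard else 0 := by
    split_ifs with h
    · obtain ⟨d, hd, h⟩ := h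
      symm
      apply Set.ncard_congr (fun t _ => (d, t))
      · exact fun t ht => ⟨hd, ht, by simp [h, hT0 t ht]⟩
      · exact fun _ _ _ _ e => (Prod.mk.inj e).2
      · rintro ⟨a, b⟩ ⟨ha, hb, e⟩
        refine ⟨b, hb, Prod.ext (hinj hd ha ?_) rfl⟩
        rw [h, ← e, hT0 b hb, sub_zero]
    · rw [Set.ncard_eq_zero, Set.eq_empty_iff_forall_notMem]
      rintro ⟨a, b⟩ ⟨ha, hb, e⟩
      exact h ⟨a, ha, by rw [← e, hT0 b hb, sub_zero]⟩
  have h3 : {p : A × A | p.1 ∈ T ∧ p.2 ∈ D \ T ∧ φ p.1 - φ p.2 = -x + y}.ncard =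
      if (addCayleyDigraph (φ '' (D \ T))).Adj y x then T.ncard else 0 := by
    split_ifs with h
    · obtain ⟨d, hd, h⟩ := h
      symm
      apply Set.ncard_congr (fun t _ => (t, d))
      · exact fun t ht => ⟨ht, hd, by simp [h, hT0 t ht, add_comm]⟩
      · exact fun _ _ _ _ e => (Prod.mk.inj e).1
      · rintro ⟨a, b⟩ ⟨ha, hb, e⟩
        refine ⟨a, ha, Prod.ext rfl (hinj hd hb ?_)⟩
        simp only [hT0 a ha, zero_sub] at e
        rw [h, ← neg_neg (φ b), e]
        abel
    · rw [Set.ncard_eq_zero, Set.eq_empty_iff_forall_notMem]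
      rintro ⟨a, b⟩ ⟨ha, hb, e⟩
      refine h ⟨b, hb, ?_⟩
      simp only [hT0 a ha, zero_sub] at e
      rw [← neg_neg (φ b), e]
      abel
  rw [← h1, ← h2, ← h3, ← Set.ncard_union_eq, ← Set.ncard_union_eq]
  · congr 1
    ext ⟨a, b⟩
    simp only [Set.mem_union, Set.mem_ofPred_eq, Set.mem_sdiff]
    constructor
    · rintro ((⟨ha, hb, h⟩ | ⟨ha, hb, h⟩) | ⟨ha, hb, h⟩)
      exacts [⟨ha.1, hb.1, h⟩, ⟨ha.1, hTD hb, h⟩, ⟨hTD ha, hb.1, h⟩]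
    · rintro ⟨ha, hb, h⟩
      have : ¬ (a ∈ T ∧ b ∈ T) := fun hab => hg (by
        rw [← h, hT0 a hab.1, hT0 b hab.2, sub_zero])
      tauto
  · rw [Set.disjoint_left]
    rintro p (⟨h, -⟩ | ⟨h, -⟩) ⟨h', -⟩
    exacts [h.2 h', h.2 h']
  · rw [Set.disjoint_left]
    rintro p ⟨-, h, -⟩ ⟨-, h', -⟩
    exact h.2 h'

theorem IsPlanarDifferenceSetIn.isNRD_map_sdiff [Finite A] [Finite B]
    (hD : IsPlanarDifferenceSetIn ⊤ D) (hT : IsPlanarDifferenceSetIn φ.ker T) (hTD : T ⊆ D)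
    (hφ : Function.Surjective φ) (hne : T.Nonempty) {l : ℕ}
    (hl : l + T.ncard = Nat.card φ.ker) :
    IsNRD (addCayleyDigraph (φ '' (D \ T))) (Nat.card B) (D.ncard - T.ncard) l
      (Nat.card φ.ker) where
  finite := inferInstance
  card_vertices := rfl
  loopless x := by
    rintro ⟨d, hd, h⟩
    exact hD.map_ne_zero hT hTD hne hd (by rw [h, neg_add_cancel])
  outdegree x := by
    rw [← Set.ncard_sdiff hTD, ← (hD.map_injOn hT hTD).ncard_image]
    refine Set.ncard_congr (fun z _ => -x + z) (fun _ h => h)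
      (fun _ _ _ _ e => add_left_cancel e) (fun b hb => ⟨x + b, ?_, by simp⟩)
    simpa [addCayleyDigraph] using hb
  common_of_none x y hxy h h' := by
    have := hD.ncard_common hT hTD hφ hxy
    simpa [h, h'] using this
  common_of_one x y hxy h := by
    have := hD.ncard_common hT hTD hφ hxy
    rcases h with ⟨h, h'⟩ | ⟨h, h'⟩
    all_goals
      simp only [h, h', if_true, if_false, add_zero] at this
      omega
  common_of_both x y hxy h h' := by
    have := hD.ncard_common hT hTD hφ hxy
    simp only [h, h', if_true] at this
    omega

end Quotient

/-! ### Subfields of finite fields and planes over them. -/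

theorem Subfield.pow_natCard {K : Type*} [Field K] [Finite K] (F : Subfield K) {x : K}
    (hx : x ∈ F) : x ^ Nat.card F = x := by
  have := Fintype.ofFinite F
  rw [Nat.card_eq_fintype_card]
  exact congrArg Subtype.val (FiniteField.pow_card (⟨x, hx⟩ : F))

theorem Subfield.pow_natCard_sub_one {K : Type*} [Field K] [Finite K] (F : Subfield K) {x : K}
    (hx : x ∈ F) (h0 : x ≠ 0) : x ^ (Nat.card F - 1) = 1 := by
  have h := F.pow_natCard hx
  rw [← Nat.sub_add_cancel (Nat.card_pos (α := F)), pow_succ] at h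
  exact mul_right_cancel₀ h0 (h.trans (one_mul x).symm)

open Polynomial in
theorem card_filter_pow_eq_self_le {K : Type*} [Field K] [Fintype K] [DecidableEq K] {n : ℕ}
    (hn : 1 < n) : (Finset.univ.filter fun x : K => x ^ n = x).card ≤ n := by
  have h0 := FiniteField.X_pow_card_sub_X_ne_zero K hn
  calc _ ≤ (X ^ n - X : K[X]).roots.toFinset.card := by
        apply Finset.card_le_card
        intro x hx
        simp only [Finset.mem_filter, Finset.mem_univ, true_and] at hx
        simp [h0, hx]
    _ ≤ Multiset.card (X ^ n - X : K[X]).roots := Multiset.toFinset_card_le _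
    _ ≤ _ := (card_roots' _).trans (FiniteField.X_pow_card_sub_X_natDegree_eq K hn).le

theorem Subfield.mem_of_pow_eq_self {K : Type*} [Field K] [Finite K] (F : Subfield K) {x : K}
    (hx : x ^ Nat.card F = x) : x ∈ F := by
  classical
  have := Fintype.ofFinite K
  have h1 : (F : Set K).toFinset = Finset.univ.filter fun x : K => x ^ Nat.card F = x := by
    apply Finset.eq_of_subset_of_card_le
    · intro y hy
      simpa using F.pow_natCard (by simpa using hy)
    · refine (card_filter_pow_eq_self_le Finite.one_lt_card).trans ?_
      rw [← Set.ncard_eq_toFinset_card']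
      exact le_rfl
  have : x ∈ (F : Set K).toFinset := by
    rw [h1]
    simpa using hx
  simpa using this

theorem Subfield.mem_span_one_pair {K : Type*} [Field K] {F : Subfield K} {b z : K} :
    z ∈ Submodule.span F ({1, b} : Set K) ↔ ∃ x ∈ F, ∃ y ∈ F, x + y * b = z := by
  rw [Submodule.mem_span_pair]
  constructor
  · rintro ⟨x, y, rfl⟩
    exact ⟨x, x.2, y, y.2, by simp [Subfield.smul_def]⟩
  · rintro ⟨x, hx, y, hy, rfl⟩
    exact ⟨⟨x, hx⟩, ⟨y, hy⟩, by simp [Subfield.smul_def]⟩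

theorem Subfield.eq_zero_of_add_mul_eq_zero {K : Type*} [Field K] {F : Subfield K} {b x y : K}
    (hb : b ∉ F) (hx : x ∈ F) (hy : y ∈ F) (h : x + y * b = 0) : x = 0 ∧ y = 0 := by
  have hy0 : y = 0 := by
    by_contra hy0
    refine hb ?_
    have : b = -x / y := by
      field_simp
      linear_combination h
    rw [this]
    exact F.div_mem (F.neg_mem hx) hy
  refine ⟨?_, hy0⟩
  simpa [hy0] using h

/-- Pigeonhole: a plane meets each of its multiples inside a three-dimensional space. -/
theorem Subfield.exists_mem_span_eq_mul {K : Type*} [Field K] [Finite K] (F : Subfield K)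
    {b c : K} (hb : b ∉ F) (hb3 : b ^ Nat.card F ^ 3 = b) (hc3 : c ^ Nat.card F ^ 3 = c)
    (hc : c ≠ 0) :
    ∃ x ∈ Submodule.span F ({1, b} : Set K), ∃ y ∈ Submodule.span F ({1, b} : Set K),
      x ≠ 0 ∧ y ≠ 0 ∧ x = c * y := by
  classical
  have := Fintype.ofFinite K
  have := Fintype.ofFinite F
  -- The points fixed by ψ stand in for the 3-space, so K itself may be larger: there are at most
  -- |F|³ of them, against |F|⁴ quadruples of coefficients.
  obtain ⟨ψ, hψ⟩ : ∃ ψ : K →ₐ[F] K, ∀ x, ψ x = x ^ Nat.card F ^ 3 :=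
    ⟨FiniteField.frobeniusAlgHom F K ^ 3, fun x => by
      rw [AlgHom.coe_pow, FiniteField.coe_frobeniusAlgHom, pow_iterate, Nat.card_eq_fintype_card]⟩
  have h1 : 1 < Nat.card F := Finite.one_lt_card
  have hlt : (Finset.univ.filter fun x : K => x ^ Nat.card F ^ 3 = x).card <
      (Finset.univ : Finset ((F × F) × F × F)).card := by
    refine (card_filter_pow_eq_self_le (Nat.one_lt_pow (by norm_num) h1)).trans_lt ?_
    rw [Finset.card_univ, Fintype.card_prod, Fintype.card_prod, ← Nat.card_eq_fintype_card]
    calc Nat.card F ^ 3 < Nat.card F ^ 4 := Nat.pow_lt_pow_right h1 (by norm_num)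
      _ = _ := by ring
  obtain ⟨s, -, t, -, hst, h⟩ := Finset.exists_ne_map_eq_of_card_lt_of_maps_to hlt
    (f := fun s => (algebraMap F K s.1.1 + algebraMap F K s.1.2 * b) -
      c * (algebraMap F K s.2.1 + algebraMap F K s.2.2 * b)) (by
      intro s _
      simp only [Finset.coe_filter, Finset.mem_univ, true_and, Set.mem_ofPred_eq]
      rw [← hψ]
      simp only [map_sub, map_add, map_mul, AlgHom.commutes, hψ b, hψ c, hb3, hc3])
  have hmem : ∀ x y : F, (x : K) + y * b ∈ Submodule.span F ({1, b} : Set K) := fun x y =>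
    Subfield.mem_span_one_pair.2 ⟨x, x.2, y, y.2, rfl⟩
  have heq : ((s.1.1 - t.1.1 : F) : K) + (s.1.2 - t.1.2 : F) * b =
      c * (((s.2.1 - t.2.1 : F) : K) + (s.2.2 - t.2.2 : F) * b) := by
    have h : ((s.1.1 : K) + s.1.2 * b) - c * (s.2.1 + s.2.2 * b) =
      (t.1.1 + t.1.2 * b) - c * (t.2.1 + t.2.2 * b) := h
    push_cast
    linear_combination h
  have hy : ((s.2.1 - t.2.1 : F) : K) + (s.2.2 - t.2.2 : F) * b ≠ 0 := by
    intro h0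
    rw [h0, mul_zero] at heq
    obtain ⟨e1, e2⟩ := Subfield.eq_zero_of_add_mul_eq_zero hb (SetLike.coe_mem _)
      (SetLike.coe_mem _) heq
    obtain ⟨e3, e4⟩ := Subfield.eq_zero_of_add_mul_eq_zero hb (SetLike.coe_mem _)
      (SetLike.coe_mem _) h0
    simp only [ZeroMemClass.coe_eq_zero, sub_eq_zero] at e1 e2 e3 e4
    exact hst (Prod.ext (Prod.ext e1 e2) (Prod.ext e3 e4))
  exact ⟨_, hmem _ _, _, hmem _ _, heq ▸ mul_ne_zero hc hy, hy, heq⟩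

/-! ### Logarithms of planes and Singer's theorem. -/

section Primitive

variable {K : Type*} [Field K] [Finite K] {α : K}

theorem exists_pow_eq_of_orderOf_eq (hα : orderOf α = Nat.card K - 1) {x : K} (hx : x ≠ 0) :
    ∃ n : ℕ, α ^ n = x := by
  have := Fintype.ofFinite K
  have h1 : 1 < Nat.card K := Finite.one_lt_card
  have : NeZero (orderOf α) := ⟨by omega⟩
  obtain ⟨n, -, hn⟩ := (IsPrimitiveRoot.orderOf α).eq_pow_of_pow_eq_one (ξ := x) (by
    rw [hα, Nat.card_eq_fintype_card]
    exact FiniteField.pow_card_sub_one_eq_one x hx)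
  exact ⟨n, hn⟩

theorem ne_zero_of_orderOf_eq (hα : orderOf α = Nat.card K - 1) : α ≠ 0 := by
  rintro rfl
  have h1 : 1 < Nat.card K := Finite.one_lt_card
  rw [orderOf_zero] at hα
  omega

/-- The exponents of `α` are determined by a point of the projective plane modulo its size. -/
theorem natCast_eq_of_pow_eq_mul {F : Subfield K} {u : ℕ} (hα : orderOf α = Nat.card K - 1)
    (hu : (Nat.card F - 1) * u = Nat.card K - 1) {m n : ℕ} {f : K} (hf : f ∈ F)
    (h : α ^ m = f * α ^ n) : (m : ZMod u) = n := by
  have h0 := ne_zero_of_orderOf_eq hα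
  have hf0 : f ≠ 0 := by
    rintro rfl
    exact pow_ne_zero m h0 (by simpa using h)
  have h1 : α ^ (m * (Nat.card F - 1)) = α ^ (n * (Nat.card F - 1)) := by
    rw [pow_mul, pow_mul, h, mul_pow, F.pow_natCard_sub_one hf hf0, one_mul]
  have hmod : m * (Nat.card F - 1) ≡ n * (Nat.card F - 1) [MOD orderOf α] := by
    have hfin : IsOfFinOrder α := isOfFinOrder_iff_pow_eq_one.2
      ⟨Nat.card K - 1, by have : 1 < Nat.card K := Finite.one_lt_card
                          omega, hα ▸ pow_orderOf_eq_one α⟩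
    exact hfin.pow_eq_pow_iff_modEq.1 h1
  rw [hα, ← hu, mul_comm m, mul_comm n] at hmod
  have : 1 < Nat.card F := Finite.one_lt_card
  exact (ZMod.natCast_eq_natCast_iff _ _ _).2
    (Nat.ModEq.mul_left_cancel' (by omega) hmod)

/-- Up to scalars from F, the nonzero vectors of the plane are 1, with logarithm 0, and f + b for f
in F. -/
theorem logSet_ncard_le {F : Subfield K} {u : ℕ} [NeZero u] {b : K}
    (hα : orderOf α = Nat.card K - 1) (hu : (Nat.card F - 1) * u = Nat.card K - 1)
    (hb : b ∉ F) : (logSet F α b u).ncard ≤ Nat.card F + 1 := by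
  classical
  have h0 := ne_zero_of_orderOf_eq hα
  have hne : ∀ f : F, (f : K) + b ≠ 0 := fun f h => hb <| by
    rw [eq_neg_of_add_eq_zero_right h]
    exact F.neg_mem f.2
  choose l hl using fun f : F => exists_pow_eq_of_orderOf_eq hα (hne f)
  have hsub : logSet F α b u ⊆ insert 0 (Set.range fun f : F => (l f : ZMod u)) := by
    rintro i ⟨n, rfl, hn⟩
    obtain ⟨x, hx, y, hy, h⟩ := Subfield.mem_span_one_pair.1 hn
    by_cases hy0 : y = 0
    · left
      rw [hy0, zero_mul, add_zero] at h
      simpa using natCast_eq_of_pow_eq_mul hα hu (n := 0) hx (by rw [pow_zero, mul_one, h])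
    · right
      refine ⟨⟨x / y, F.div_mem hx hy⟩, ?_⟩
      refine (natCast_eq_of_pow_eq_mul hα hu hy ?_).symm
      rw [hl, ← h]
      field_simp
  refine (Set.ncard_le_ncard hsub (Set.toFinite _)).trans ((Set.ncard_insert_le _ _).trans ?_)
  gcongr
  rw [← Set.image_univ]
  exact (Set.ncard_image_le (Set.toFinite _)).trans (Set.ncard_univ F).le

/-- Only b and α ^ k need be fixed by the |F|³ power map; this serves both D and, with the smaller
field, T. -/
theorem exists_mem_logSet_sub_eq {F : Subfield K} {u k : ℕ} {b : K}
    (hα : orderOf α = Nat.card K - 1) (hu : u ∣ Nat.card K - 1)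
    (hb : b ∉ F) (hb3 : b ^ Nat.card F ^ 3 = b) (hk : (α ^ k) ^ Nat.card F ^ 3 = α ^ k) :
    ∃ p : ZMod u × ZMod u, p.1 ∈ logSet F α b u ∧ p.2 ∈ logSet F α b u ∧ p.1 - p.2 = k := by
  have h0 := ne_zero_of_orderOf_eq hα
  obtain ⟨x, hx, y, hy, hx0, hy0, h⟩ := F.exists_mem_span_eq_mul hb hb3 hk (pow_ne_zero k h0)
  obtain ⟨m, rfl⟩ := exists_pow_eq_of_orderOf_eq hα hx0
  obtain ⟨n, rfl⟩ := exists_pow_eq_of_orderOf_eq hα hy0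
  refine ⟨(m, n), ⟨m, rfl, hx⟩, ⟨n, rfl, hy⟩, ?_⟩
  obtain ⟨c, hc⟩ := hu
  have hmod : m ≡ k + n [MOD orderOf α] := by
    have hfin : IsOfFinOrder α := isOfFinOrder_iff_pow_eq_one.2
      ⟨Nat.card K - 1, by have : 1 < Nat.card K := Finite.one_lt_card
                          omega, hα ▸ pow_orderOf_eq_one α⟩
    exact hfin.pow_eq_pow_iff_modEq.1 (by rw [h, pow_add])
  have := (ZMod.natCast_eq_natCast_iff m (k + n) u).2
    (hmod.of_dvd (hα ▸ hc ▸ dvd_mul_right u c))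
  simp only [this, Nat.cast_add, add_sub_cancel_right]

theorem isPlanarDifferenceSetIn_logSet {F : Subfield K} {u : ℕ} {b : K}
    (hα : orderOf α = Nat.card K - 1) (hK : Nat.card K = Nat.card F ^ 3)
    (hu : u = Nat.card F ^ 2 + Nat.card F + 1) (hb : b ∉ F) :
    IsPlanarDifferenceSetIn ⊤ (logSet F α b u) := by
  have : NeZero u := ⟨by omega⟩
  have := Fintype.ofFinite K
  have hpow : ∀ x : K, x ^ Nat.card F ^ 3 = x := fun x => by
    rw [← hK, Nat.card_eq_fintype_card]
    exact FiniteField.pow_card x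
  have hfac : (Nat.card F - 1) * u = Nat.card K - 1 := by
    rw [hK, hu]
    obtain ⟨c, hc⟩ := Nat.exists_eq_add_of_le' (Nat.card_pos (α := F))
    rw [hc, Nat.add_sub_cancel]
    apply Nat.eq_sub_of_add_eq
    ring
  refine isPlanarDifferenceSetIn_top_of_ncard_le ?_ (logSet_ncard_le hα hfac hb) ?_
  · rw [Nat.card_zmod, hu, Nat.add_sub_cancel]
    ring
  · intro g _
    have := exists_mem_logSet_sub_eq (k := g.val) hα (Dvd.intro_left _ hfac) hb (hpow _) (hpow _)
    rwa [ZMod.natCast_zmod_val] at this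

end Primitive

/-! ### Arithmetic of the parameters and of `ZMod`. -/

theorem sq_add_self_add_one_dvd {q r : ℕ} (hr3 : ¬ 3 ∣ r) :
    q ^ 2 + q + 1 ∣ q ^ (2 * r) + q ^ r + 1 := by
  -- Hence only r mod 3 matters.
  have h3 : (q : ℤ) ^ 3 ≡ 1 [ZMOD (q : ℤ) ^ 2 + q + 1] :=
    (Int.modEq_iff_dvd.2 ⟨q - 1, by ring⟩).symm
  have hk : ∀ k : ℕ, ((q : ℤ) ^ 3) ^ k ≡ 1 [ZMOD (q : ℤ) ^ 2 + q + 1] := fun k => by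
    simpa using h3.pow k
  zify
  rw [← Int.modEq_zero_iff_dvd]
  obtain ⟨k, hk' | hk'⟩ : ∃ k, r = 3 * k + 1 ∨ r = 3 * k + 2 := ⟨r / 3, by omega⟩
  · have e : (q : ℤ) ^ (2 * r) + q ^ r + 1 =
        (((q : ℤ) ^ 3) ^ k) ^ 2 * q ^ 2 + ((q : ℤ) ^ 3) ^ k * q + 1 := by
      rw [hk']; ring
    rw [e]
    refine (((((hk k).pow 2).mul_right _).add ((hk k).mul_right _)).add_right 1).trans ?_
    exact Int.modEq_zero_iff_dvd.2 ⟨1, by ring⟩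
  · have e : (q : ℤ) ^ (2 * r) + q ^ r + 1 =
        (((q : ℤ) ^ 3) ^ k) ^ 2 * q ^ 4 + ((q : ℤ) ^ 3) ^ k * q ^ 2 + 1 := by
      rw [hk']; ring
    rw [e]
    refine (((((hk k).pow 2).mul_right _).add ((hk k).mul_right _)).add_right 1).trans ?_
    exact Int.modEq_zero_iff_dvd.2 ⟨q ^ 2 - q + 1, by ring⟩

theorem eq_succ_of_mul_pred_eq {a b : ℕ} (hb : 0 < b) (h : a * (a - 1) = b * (b + 1)) :
    a = b + 1 := by
  obtain _ | c := a
  · simp only [zero_mul] at h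
    exact absurd h (by positivity)
  · rw [Nat.add_sub_cancel] at h
    rcases lt_trichotomy c b with hc | hc | hc
    · nlinarith
    · rw [hc]
    · nlinarith

theorem ZMod.ker_castHom_eq_zmultiples {u v : ℕ} [NeZero u] (h : v ∣ u) :
    (ZMod.castHom h (ZMod v)).toAddMonoidHom.ker = AddSubgroup.zmultiples (v : ZMod u) := by
  ext x
  rw [AddMonoidHom.mem_ker, AddSubgroup.mem_zmultiples_iff]
  constructor
  · intro hx
    have hx : ZMod.castHom h (ZMod v) x = 0 := hx
    rw [← ZMod.natCast_zmod_val x, map_natCast, ZMod.natCast_eq_zero_iff] at hx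
    obtain ⟨k, hk⟩ := hx
    refine ⟨k, ?_⟩
    rw [← ZMod.natCast_zmod_val x, hk]
    simp [mul_comm]
  · rintro ⟨k, rfl⟩
    change ZMod.castHom h (ZMod v) (k • (v : ZMod u)) = 0
    rw [map_zsmul, map_natCast, ZMod.natCast_self, smul_zero]

theorem exists_mul_modEq_of_coprime {a n : ℕ} (hn : n ≠ 0) (h : a.Coprime n) (i : ℕ) :
    ∃ j, a * j ≡ i [MOD n] := by
  have : NeZero n := ⟨hn⟩
  refine ⟨((a : ZMod n)⁻¹ * i).val, ?_⟩
  rw [← ZMod.natCast_eq_natCast_iff, Nat.cast_mul, ZMod.natCast_zmod_val, ← mul_assoc,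
    ZMod.coe_mul_inv_eq_one a h, one_mul]

/-- Divide gcd(q^r - 1, q³ - 1) = q^gcd(r,3) - 1 = q - 1 by q - 1. -/
theorem coprime_div_sub_one {q r : ℕ} (hq : 2 ≤ q) (hr3 : ¬ 3 ∣ r) :
    ((q ^ r - 1) / (q - 1)).Coprime (q ^ 2 + q + 1) := by
  have h1 : (q ^ r - 1) / (q - 1) * (q - 1) = q ^ r - 1 :=
    Nat.div_mul_cancel (by simpa using Nat.pow_sub_one_dvd_pow_sub_one q (one_dvd r))
  have h2 : (q ^ 2 + q + 1) * (q - 1) = q ^ 3 - 1 := by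
    obtain ⟨c, rfl⟩ := Nat.exists_eq_add_of_le' (show 1 ≤ q by omega)
    rw [Nat.add_sub_cancel]
    apply Nat.eq_sub_of_add_eq
    ring
  have h3 := Nat.pow_sub_one_gcd_pow_sub_one q r 3
  have hg : r.gcd 3 = 1 := Nat.Coprime.symm ((Nat.Prime.coprime_iff_not_dvd Nat.prime_three).2 hr3)
  rw [hg, pow_one, ← h1, ← h2, Nat.gcd_mul_right] at h3
  exact Nat.eq_of_mul_eq_mul_right (show 0 < q - 1 by omega) (h3.trans (one_mul _).symm)

/-! ### The sets D and T together. -/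

section Singer

variable {K : Type*} [Field K] {F E : Subfield K} {α b : K} {q r u v : ℕ}

theorem logSet_mono (h : E ≤ F) : logSet E α b u ⊆ logSet F α b u := by
  rintro i ⟨n, hn, hmem⟩
  obtain ⟨x, hx, y, hy, e⟩ := Subfield.mem_span_one_pair.1 hmem
  exact ⟨n, hn, Subfield.mem_span_one_pair.2 ⟨x, h hx, y, h hy, e⟩⟩

theorem zero_mem_logSet : (0 : ZMod u) ∈ logSet E α b u :=
  ⟨0, by simp, Submodule.subset_span (by simp)⟩

variable [Finite K]

theorem Subfield.le_of_natCard_eq_pow (hF : Nat.card F = q ^ r) (hE : Nat.card E = q) :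
    E ≤ F := by
  intro x hx
  apply F.mem_of_pow_eq_self
  have h := E.pow_natCard hx
  rw [hE] at h
  rw [hF]
  clear hF
  induction r with
  | zero => simp
  | succ r ih => rw [pow_succ, pow_mul, ih, h]

theorem notMem_of_orderOf_eq (hq : 2 ≤ q) (hr3 : ¬ 3 ∣ r) (hF : Nat.card F = q ^ r)
    (hb : orderOf b = q ^ 3 - 1) : b ∉ F := by
  intro hmem
  have hq3 : q < q ^ 3 := lt_self_pow₀ (by omega) (by norm_num)
  have hb0 : b ≠ 0 := by
    rintro rfl
    rw [orderOf_zero] at hb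
    omega
  have h1 := orderOf_dvd_of_pow_eq_one (F.pow_natCard_sub_one hmem hb0)
  rw [hb, hF] at h1
  have h2 := Nat.pow_sub_one_gcd_pow_sub_one q r 3
  have hg : r.gcd 3 = 1 := Nat.Coprime.symm ((Nat.Prime.coprime_iff_not_dvd Nat.prime_three).2 hr3)
  rw [Nat.gcd_eq_right h1, hg, pow_one] at h2
  omega

/-- The E-span of 1 and b is fixed by the |E|³ power map, so the exponents of its nonzero elements
are multiples of M. -/
theorem logSet_subset_zmultiples {M : ℕ} (hα : orderOf α = Nat.card K - 1)
    (hM : M * (Nat.card E ^ 3 - 1) = Nat.card K - 1) (hb : b = α ^ M) (hvM : v ∣ M) :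
    logSet E α b u ⊆ (AddSubgroup.zmultiples (v : ZMod u) : Set (ZMod u)) := by
  have := Fintype.ofFinite K
  have := Fintype.ofFinite E
  have hα0 := ne_zero_of_orderOf_eq hα
  have hcard : 1 < Nat.card E := Finite.one_lt_card
  have hpos : 1 < Nat.card E ^ 3 := Nat.one_lt_pow (by norm_num) hcard
  obtain ⟨ψ, hψ⟩ : ∃ ψ : K →ₐ[E] K, ∀ x, ψ x = x ^ Nat.card E ^ 3 :=
    ⟨FiniteField.frobeniusAlgHom E K ^ 3, fun x => by
      rw [AlgHom.coe_pow, FiniteField.coe_frobeniusAlgHom, pow_iterate, Nat.card_eq_fintype_card]⟩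
  have hbψ : ψ b = b := by
    rw [hψ, ← Nat.sub_add_cancel hpos.le, pow_succ, hb, ← pow_mul, hM, ← hα, pow_orderOf_eq_one,
      one_mul]
  rintro i ⟨n, rfl, hn⟩
  obtain ⟨x, hx, y, hy, h⟩ := Subfield.mem_span_one_pair.1 hn
  have hfix : (α ^ n) ^ Nat.card E ^ 3 = α ^ n := by
    rw [← hψ, ← h, map_add, map_mul, hbψ]
    congr 1
    · exact ψ.commutes ⟨x, hx⟩
    · congr 1
      exact ψ.commutes ⟨y, hy⟩
  rw [← Nat.sub_add_cancel hpos.le, pow_succ] at hfix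
  have h1 : α ^ (n * (Nat.card E ^ 3 - 1)) = 1 := by
    rw [pow_mul]
    exact mul_right_cancel₀ (pow_ne_zero n hα0) (hfix.trans (one_mul _).symm)
  have h2 := orderOf_dvd_of_pow_eq_one h1
  rw [hα, ← hM] at h2
  obtain ⟨k, rfl⟩ := hvM.trans (Nat.dvd_of_mul_dvd_mul_right (by omega) h2)
  exact AddSubgroup.mem_zmultiples_iff.2 ⟨k, by simp [mul_comm]⟩

theorem isNRD_logSet (hq : 2 ≤ q) (hr : 0 < r) (hr3 : ¬ 3 ∣ r)
    (hu : u = q ^ (2 * r) + q ^ r + 1) (hv : v = u / (q ^ 2 + q + 1))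
    (hK : Nat.card K = q ^ (3 * r)) (hF : Nat.card F = q ^ r) (hE : Nat.card E = q)
    (hα : orderOf α = q ^ (3 * r) - 1) (hb : b = α ^ ((q ^ (3 * r) - 1) / (q ^ 3 - 1))) :
    IsPlanarDifferenceSetIn ⊤ (logSet F α b u) ∧
    logSet E α b u ⊆ logSet F α b u ∧
    IsPlanarDifferenceSetIn (AddSubgroup.zmultiples (v : ZMod u)) (logSet E α b u) ∧
    (0 : ZMod v) ∉ (ZMod.cast : ZMod u → ZMod v) '' (logSet F α b u \ logSet E α b u) ∧
    IsNRD (addCayleyDigraph ((ZMod.cast : ZMod u → ZMod v) ''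
      (logSet F α b u \ logSet E α b u))) v (q ^ r - q) (q ^ 2) (q ^ 2 + q + 1) := by
  have hw : v * (q ^ 2 + q + 1) = u := by
    rw [hv, Nat.div_mul_cancel]
    rw [hu]
    exact sq_add_self_add_one_dvd hr3
  have hvu : v ∣ u := Dvd.intro _ hw
  have hu0 : u ≠ 0 := by omega
  have : NeZero u := ⟨hu0⟩
  have : NeZero v := ⟨fun h => hu0 (by rw [← hw, h, zero_mul])⟩
  have hQ : q ≤ q ^ r := Nat.le_self_pow hr.ne' q
  have hq3 : 1 < q ^ 3 := Nat.one_lt_pow (by norm_num) hq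
  have hKF : Nat.card K = Nat.card F ^ 3 := by rw [hK, hF, ← pow_mul, mul_comm]
  have huF : u = Nat.card F ^ 2 + Nat.card F + 1 := by rw [hu, hF, ← pow_mul, mul_comm r]
  rw [← hK] at hα
  have hdvd : q ^ 3 - 1 ∣ q ^ (3 * r) - 1 := Nat.pow_sub_one_dvd_pow_sub_one q (dvd_mul_right 3 r)
  set M := (q ^ (3 * r) - 1) / (q ^ 3 - 1)
  have hM : M * (q ^ 3 - 1) = Nat.card K - 1 := by rw [hK, Nat.div_mul_cancel hdvd]
  have hK1 : 1 < Nat.card K := Finite.one_lt_card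
  have hM0 : M ≠ 0 := by
    intro h
    rw [h, zero_mul] at hM
    omega
  have hord : orderOf b = q ^ 3 - 1 := by
    rw [hb, orderOf_pow_of_dvd hM0 (hα ▸ hM ▸ dvd_mul_right _ _), hα, ← hM,
      Nat.mul_div_cancel_left _ (Nat.pos_of_ne_zero hM0)]
  have hEF := Subfield.le_of_natCard_eq_pow hF hE
  have hbF := notMem_of_orderOf_eq hq hr3 hF hord
  have hD := isPlanarDifferenceSetIn_logSet (b := b) hα hKF huF hbF
  have hTD : logSet E α b u ⊆ logSet F α b u := logSet_mono hEF
  have hfac : (q ^ r - 1) * u = Nat.card K - 1 := by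
    rw [hKF, huF, hF]
    obtain ⟨c, hc⟩ := Nat.exists_eq_add_of_le' (show 1 ≤ q ^ r by omega)
    rw [hc, Nat.add_sub_cancel]
    apply Nat.eq_sub_of_add_eq
    ring
  have hfac3 : (q - 1) * (q ^ 2 + q + 1) = q ^ 3 - 1 := by
    obtain ⟨c, rfl⟩ := Nat.exists_eq_add_of_le' (show 1 ≤ q by omega)
    rw [Nat.add_sub_cancel]
    apply Nat.eq_sub_of_add_eq
    ring
  have hP : (q ^ r - 1) / (q - 1) * (q - 1) = q ^ r - 1 :=
    Nat.div_mul_cancel (by simpa using Nat.pow_sub_one_dvd_pow_sub_one q (one_dvd r))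
  have hPco := coprime_div_sub_one hq hr3
  set P := (q ^ r - 1) / (q - 1)
  -- As P is invertible modulo q²+q+1 = u/v, the multiples of M modulo u fill ⟨v⟩: every element of
  -- ⟨v⟩ is the logarithm of a power of b.
  have hMP : M = v * P := by
    apply Nat.eq_of_mul_eq_mul_right (show 0 < q ^ 3 - 1 by omega)
    rw [hM, ← hfac, ← hP, ← hw, ← hfac3]
    ring
  have hT : IsPlanarDifferenceSetIn (AddSubgroup.zmultiples (v : ZMod u)) (logSet E α b u) := by
    refine ⟨logSet_subset_zmultiples hα (by rw [hE, hM]) hb (hMP ▸ dvd_mul_right v P),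
      fun g hg g0 => ?_⟩
    obtain ⟨i, rfl⟩ : ∃ i : ℕ, ((v * i : ℕ) : ZMod u) = g := by
      rw [← mem_multiples_iff_mem_zmultiples] at hg
      obtain ⟨i, rfl⟩ := (AddSubmonoid.mem_multiples_iff _ _).1 hg
      exact ⟨i, by simp [mul_comm]⟩
    obtain ⟨j, hj⟩ := exists_mul_modEq_of_coprime (by positivity) hPco i
    have hcast : ((M * j : ℕ) : ZMod u) = (v * i : ℕ) := by
      rw [ZMod.natCast_eq_natCast_iff, hMP, ← hw, mul_assoc]
      exact hj.mul_left' v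
    have hfix : b ^ q ^ 3 = b := by
      rw [← Nat.sub_add_cancel hq3.le, pow_succ, ← hord, pow_orderOf_eq_one, one_mul]
    obtain ⟨p, h1, h2, h3⟩ := exists_mem_logSet_sub_eq (F := E) (u := u) (k := M * j) (b := b) hα
      (Dvd.intro_left _ hfac) (fun h => hbF (hEF h)) (by rw [hE, hfix])
      (by rw [hE, pow_mul, ← hb, pow_right_comm, hfix])
    rw [hcast] at h3
    -- Uniqueness needs no counting here: T lies in D.
    exact ⟨p, ⟨h1, h2, h3⟩, fun p' ⟨h1', h2', h3'⟩ =>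
      (hD.2 _ trivial g0).unique ⟨hTD h1', hTD h2', h3'⟩ ⟨hTD h1, hTD h2, h3⟩⟩
  refine ⟨hD, hTD, hT, ?_⟩
  have hker := ZMod.ker_castHom_eq_zmultiples hvu
  have hφ : Function.Surjective (ZMod.castHom hvu (ZMod v)).toAddMonoidHom :=
    ZMod.castHom_surjective hvu
  have hcardker : Nat.card (ZMod.castHom hvu (ZMod v)).toAddMonoidHom.ker = q ^ 2 + q + 1 := by
    have h := (ZMod.castHom hvu (ZMod v)).toAddMonoidHom.ker.card_mul_index
    rw [AddSubgroup.index_ker, AddMonoidHom.range_eq_top.2 hφ, AddSubgroup.card_top, Nat.card_zmod,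
      Nat.card_zmod] at h
    exact Nat.eq_of_mul_eq_mul_left (NeZero.pos v) ((mul_comm _ _).trans (h.trans hw.symm))
  have hTn := hT.ncard_mul_pred
  have hDn := hD.ncard_mul_pred
  rw [← hker, hcardker, Nat.add_sub_cancel] at hTn
  have hu1 : u - 1 = q ^ r * (q ^ r + 1) := by
    rw [huF, hF, Nat.add_sub_cancel]
    ring
  rw [AddSubgroup.card_top, Nat.card_zmod, hu1] at hDn
  -- Planarity determines the sizes: |T| = q+1, and then |D| = q^r+1.
  have hTn := eq_succ_of_mul_pred_eq (by omega) (hTn.trans (by ring : _ = q * (q + 1)))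
  have hDn := eq_succ_of_mul_pred_eq (by omega) hDn
  rw [← hker] at hT
  have hne : (logSet E α b u).Nonempty := ⟨0, zero_mem_logSet⟩
  constructor
  · rintro ⟨d, hd, h⟩
    exact hD.map_ne_zero hT hTD hne hd h
  · have h := hD.isNRD_map_sdiff hT hTD hφ hne (l := q ^ 2) (by rw [hTn, hcardker]; ring)
    rw [hcardker, Nat.card_zmod, hTn, hDn, Nat.add_sub_add_right] at h
    exact h

end Singer

/-! ### Existence of the fields and the final statement. -/

theorem exists_subfield_natCard_eq {K : Type*} [Field K] [Finite K] {p n m : ℕ} [Fact p.Prime]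
    [Algebra (ZMod p) K] (hn : n ≠ 0) (hK : Nat.card K = p ^ m) (h : n ∣ m) :
    ∃ F : Subfield K, Nat.card F = p ^ n := by
  have hfin : Module.finrank (ZMod p) K = m := by
    have := FiniteField.pow_finrank_eq_natCard p K
    rw [hK] at this
    exact Nat.pow_right_injective (Fact.out : p.Prime).two_le this
  obtain ⟨f⟩ := FiniteField.nonempty_algHom_of_finrank_dvd (F := ZMod p) (K := GaloisField p n)
    (L := K) (by rwa [GaloisField.finrank p hn, hfin])
  refine ⟨f.toRingHom.fieldRange, ?_⟩
  rw [← GaloisField.card p n hn]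
  exact (Nat.card_congr (Equiv.ofInjective f f.toRingHom.injective)).symm

theorem exists_orderOf_eq_natCard_sub_one (K : Type*) [Field K] [Finite K] :
    ∃ α : K, orderOf α = Nat.card K - 1 := by
  obtain ⟨g, hg⟩ := IsCyclic.exists_ofOrder_eq_natCard (α := Kˣ)
  exact ⟨g, by rw [orderOf_units, hg, Nat.card_units]⟩

theorem mainTheorem10 (q r u v : ℕ) (hq : IsPrimePow q) (hr : 2 ≤ r) (hr3 : ¬ 3 ∣ r)
    (hu : u = q ^ (2 * r) + q ^ r + 1) (hv : v = u / (q ^ 2 + q + 1)) :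
    (q ^ 2 + q + 1) ∣ u ∧
    (∃ S : Set (ZMod v), (0 : ZMod v) ∉ S ∧
      IsNRD (addCayleyDigraph S) v (q ^ r - q) (q ^ 2) (q ^ 2 + q + 1)) ∧
    (∀ (K : Type*) [Field K] (F E : Subfield K) (α β : K),
      Nat.card K = q ^ (3 * r) → Nat.card F = q ^ r → Nat.card E = q →
      orderOf α = q ^ (3 * r) - 1 → β = α ^ ((q ^ (3 * r) - 1) / (q ^ 3 - 1)) →
      ∀ (D T : Set (ZMod u)) (S : Set (ZMod v)),
        D = logSet F α β u → T = logSet E α β u →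
        S = (ZMod.cast : ZMod u → ZMod v) '' (D \ T) →
        IsPlanarDifferenceSetIn ⊤ D ∧
        T ⊆ D ∧
        IsPlanarDifferenceSetIn (AddSubgroup.zmultiples (v : ZMod u)) T ∧
        (0 : ZMod v) ∉ S ∧
        IsNRD (addCayleyDigraph S) v (q ^ r - q) (q ^ 2) (q ^ 2 + q + 1)) := by
  have hq2 : 2 ≤ q := hq.two_le
  refine ⟨hu ▸ sq_add_self_add_one_dvd hr3, ?_, ?_⟩
  · obtain ⟨p, n, hp, hn, rfl⟩ := (isPrimePow_nat_iff q).1 hq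
    have : Fact p.Prime := ⟨hp⟩
    have hK : Nat.card (GaloisField p (n * (3 * r))) = p ^ (n * (3 * r)) :=
      GaloisField.card p _ (by positivity)
    obtain ⟨F, hF⟩ := exists_subfield_natCard_eq (n := n * r) (by positivity) hK ⟨3, by ring⟩
    obtain ⟨E, hE⟩ := exists_subfield_natCard_eq hn.ne' hK (dvd_mul_right _ _)
    obtain ⟨α, hα⟩ := exists_orderOf_eq_natCard_sub_one (GaloisField p (n * (3 * r)))
    rw [pow_mul] at hK hF
    exact ⟨_, (isNRD_logSet hq2 (by omega) hr3 hu hv hK hF hE (hK ▸ hα) rfl).2.2.2⟩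
  · rintro K _ F E α β hK hF hE hα hβ D T S rfl rfl rfl
    have : Finite K := Nat.finite_of_card_ne_zero (by rw [hK]; positivity)
    exact isNRD_logSet hq2 (by omega) hr3 hu hv hK hF hE hα hβ
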